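/- Let $d$ be a positive integer and $\varepsilon>0$. For a $d$-tuple $X=(X_1,\dots,X_d)$ of complex $n\times n$ matrices put $\|X\|=\max_i\|X_i\|$ (operator norm), and for a word $I$ in the letters $x_1,\dots,x_d$ let $X^I$ be the corresponding product of the $X_i$ ($X^{\emptyset}=1$); $I^*$ is the word $I$ with its letters reversed. Let $D$ be the set of all $d$-tuples of self-adjoint matrices, of all sizes $n$, with $\|X\|<d+\varepsilon$. Matrices are ordered by $A\le B$ iff $B-A$ is positive semidefinite, and tuples entrywise. Let $f$ be a real free function on $D$: it sends $d$-tuples of $n\times n$ matrices in $D$ to self-adjoint $n\times n$ matrices, $f(X\oplus Y)=f(X)\oplus f(Y)$, and $f(U^*XU)=U^*f(X)U$ for every unitary $U$. Suppose that $f$ is real analytic, that is: for every $n$, every $A_0\in D$ of size $n$, every real basis $F_1,\dots,F_{dn^2}$ of the space of $d$-tuples of self-adjoint $n\times n$ matrices whose entries $(F_i)_j$ are all positive semidefinite, and all $u,v\in\mathbb C^n$, there are $\delta>0$ and complex coefficients $a_J$ such that for every $k$ and every $dn^2$-tuple $X$ of self-adjoint $k\times k$ matrices with $\|X\|<\delta$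 the point $A_0\otimes I_k+\sum_iF_i\otimes X_i$ lies in $D$ and $(u^*\otimes I_k)\,f\bigl(A_0\otimes I_k+\sum_iF_i\otimes X_i\bigr)\,(v\otimes I_k)=\sum_Ja_JX^J$, summed over the words $J$ in $dn^2$ letters. Suppose also that $$f(X)=\sum_Ic_IX^I\qquad\text{for all }X\in D,$$ where $c_I\in\mathbb C$ and the series converges when its terms are summed one after the other in some fixed enumeration of the words (absolute convergence is not assumed). For $1\le k\le d$ the $x_k$-localizing matrix of coefficients is the infinite matrix $(c_{I^*x_kJ})_{I,J}$, with rows and columns indexed by all words in $x_1,\dots,x_d$. It is called positive semidefinite if it is Hermitian and its quadratic form is nonnegative on finitely supported vectors. Then the following hold. 1. If $f$ is locally monotone on $D$, that is, for all $X\in D$ and all tuples $H\ge0$ of the same size the derivative $Df(X)[H]=\frac{d}{dt}\big|_{t=0}f(X+tH)$ exists and is positive semidefinite, then for each $k$ the $x_k$-localizing matrix is positive semidefinite, and it is the matrix of a positive semidefinite compact operator on $\ell^2$ of the set of words. 2. The function $f$ is matrix monotone on the set of self-adjoint tuples with $\|X\|\le\frac1d$ (that is, $X\le Y$ implies $f(X)\le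 f(Y)$ for $X,Y$ of the same size in this set) if and only if for each $k$ the $x_k$-localizing matrix is positive semidefinite. -/

import Mathlib

open scoped Matrix.Norms.L2Operator ComplexOrder Kronecker Topology

/-- Words in the letters `x_1, …, x_d`; the empty list is the empty word. -/
abbrev Word (d : ℕ) : Type := List (Fin d)

/-- `d`-tuples of complex `n × n` matrices. The norm of a tuple is the maximum of the operator
norms of its entries (supremum norm on the product, `ℓ²` operator norm on matrices). -/
abbrev MatTuple (d n : ℕ) : Type := Fin d → Matrix (Fin n) (Fin n) ℂ

/-- A graded function: it sends `d`-tuples of `n × n` matrices to `n × n` matrices.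
Only the values on the domain under consideration are ever used. -/
abbrev GradedFun (d : ℕ) : Type := ∀ n : ℕ, MatTuple d n → Matrix (Fin n) (Fin n) ℂ

/-- The tuple consists of self-adjoint matrices. -/
def IsSelfAdjointTuple {d n : ℕ} (X : MatTuple d n) : Prop := ∀ i, (X i).IsHermitian

/-- The monomial `X^I`: the product of the `X_i` along the letters of the word `I`. -/
def wordEval {d n : ℕ} (X : MatTuple d n) (I : Word d) : Matrix (Fin n) (Fin n) ℂ :=
  (I.map X).prod

/-- Direct sum of an `n × n` and an `m × m` matrix, as an `(n + m) × (n + m)` matrix. -/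
def matSum {n m : ℕ} (A : Matrix (Fin n) (Fin n) ℂ) (B : Matrix (Fin m) (Fin m) ℂ) :
    Matrix (Fin (n + m)) (Fin (n + m)) ℂ :=
  Matrix.reindex finSumFinEquiv finSumFinEquiv (Matrix.fromBlocks A 0 0 B)

/-- Tensor product of an `n × n` and a `k × k` matrix, as an `nk × nk` matrix. -/
def matTensor {n k : ℕ} (A : Matrix (Fin n) (Fin n) ℂ) (B : Matrix (Fin k) (Fin k) ℂ) :
    Matrix (Fin (n * k)) (Fin (n * k)) ℂ :=
  Matrix.reindex finProdFinEquiv finProdFinEquiv (A ⊗ₖ B)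

/-- The open ball `‖X‖ < r` in the universe of self-adjoint `d`-tuples, level by level. -/
def realBall (d : ℕ) (r : ℝ) (n : ℕ) : Set (MatTuple d n) :=
  {X | IsSelfAdjointTuple X ∧ ‖X‖ < r}

/-- The closed ball `‖X‖ ≤ r` in the universe of self-adjoint `d`-tuples, level by level. -/
def realClosedBall (d : ℕ) (r : ℝ) (n : ℕ) : Set (MatTuple d n) :=
  {X | IsSelfAdjointTuple X ∧ ‖X‖ ≤ r}

/-- `f` is a real free function on `D`: its values are self-adjoint, it respects direct sums,
and it respects unitary similarity. -/
structure IsRealFree {d : ℕ} (D : ∀ n, Set (MatTuple d n)) (f : GradedFun d) : Prop where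
  isHermitian : ∀ (n : ℕ), ∀ X ∈ D n, (f n X).IsHermitian
  map_sum : ∀ (n m : ℕ), ∀ X ∈ D n, ∀ Y ∈ D m, (fun i => matSum (X i) (Y i)) ∈ D (n + m) →
    f (n + m) (fun i => matSum (X i) (Y i)) = matSum (f n X) (f m Y)
  map_unitary : ∀ (n : ℕ), ∀ X ∈ D n, ∀ U ∈ Matrix.unitaryGroup (Fin n) ℂ,
    (fun i => star U * X i * U) ∈ D n →
    f n (fun i => star U * X i * U) = star U * f n X * U

/-- An `n`-frame: a real basis of the space of self-adjoint `d`-tuples of `n × n` matrices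
all of whose entries are positive semidefinite. -/
structure IsFrame {d n : ℕ} (F : Fin (d * n ^ 2) → MatTuple d n) : Prop where
  linearIndependent : LinearIndependent ℝ F
  span_eq : (Submodule.span ℝ (Set.range F) : Set (MatTuple d n)) = {X | IsSelfAdjointTuple X}
  posSemidef : ∀ i j, (F i j).PosSemidef

/-- The point `A₀ ⊗ I + X_F`, where `X_F = ∑ i, F_i ⊗ X_i`. -/
def framePoint {d n k : ℕ} (A₀ : MatTuple d n) (F : Fin (d * n ^ 2) → MatTuple d n)
    (X : MatTuple (d * n ^ 2) k) : MatTuple d (n * k) :=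
  fun j => matTensor (A₀ j) 1 + ∑ i, matTensor (F i j) (X i)

/-- The `k × k` matrix `(u* ⊗ I) M (v ⊗ I)`. -/
def compress {n k : ℕ} (u v : Fin n → ℂ) (M : Matrix (Fin (n * k)) (Fin (n * k)) ℂ) :
    Matrix (Fin k) (Fin k) ℂ :=
  fun a b => ∑ p, ∑ q, star (u p) * M (finProdFinEquiv (p, a)) (finProdFinEquiv (q, b)) * v q

/-- `f` is real analytic on `D`: around every point and in every frame, each entry of `f` is given
by a free power series in the local coordinates, on a neighbourhood that is uniform in the size
of the matrices. -/
def IsRealAnalytic {d : ℕ} (D : ∀ n, Set (MatTuple d n)) (f : GradedFun d) : Prop :=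
  ∀ (n : ℕ), ∀ A₀ ∈ D n, ∀ F : Fin (d * n ^ 2) → MatTuple d n, IsFrame F →
    ∀ u v : Fin n → ℂ, ∃ δ > (0 : ℝ), ∃ c : Word (d * n ^ 2) → ℂ,
      ∀ (k : ℕ) (X : MatTuple (d * n ^ 2) k), IsSelfAdjointTuple X → ‖X‖ < δ →
        framePoint A₀ F X ∈ D (n * k) ∧
        HasSum (fun I => c I • wordEval X I) (compress u v (f (n * k) (framePoint A₀ F X)))

/-- `f` is locally monotone on `D`: at every point the directional derivative of `f` exists and is
positive semidefinite in every positive semidefinite direction. -/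
def IsLocallyMonotone {d : ℕ} (D : ∀ n, Set (MatTuple d n)) (f : GradedFun d) : Prop :=
  ∀ (n : ℕ), ∀ X ∈ D n, ∀ H : MatTuple d n, (∀ i, (H i).PosSemidef) →
    ∃ L : Matrix (Fin n) (Fin n) ℂ,
      HasDerivAt (fun t : ℝ => f n (X + t • H)) L 0 ∧ L.PosSemidef

/-- `f` is matrix monotone on `S`: `X ≤ Y` implies `f X ≤ f Y`. -/
def IsMatrixMonotoneOn {d : ℕ} (S : ∀ n, Set (MatTuple d n)) (f : GradedFun d) : Prop :=
  ∀ (n : ℕ), ∀ X ∈ S n, ∀ Y ∈ S n, (∀ i, (Y i - X i).PosSemidef) → (f n Y - f n X).PosSemidef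

/-- On `D`, the function `f` is the sum of the free power series `∑ c_I X^I`, the words being
summed one after the other in the order given by the enumeration `e`. Nothing is said about
absolute convergence. -/
def HasPowerSeriesOn {d : ℕ} (e : ℕ ≃ Word d) (c : Word d → ℂ) (D : ∀ n, Set (MatTuple d n))
    (f : GradedFun d) : Prop :=
  ∀ (n : ℕ), ∀ X ∈ D n,
    Filter.Tendsto (fun N : ℕ => ∑ j ∈ Finset.range N, c (e j) • wordEval X (e j))
      Filter.atTop (𝓝 (f n X))

/-- The `x_k`-localizing matrix of coefficients: its `(I, J)` entry is `c_{I* x_k J}`, where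
`I*` is the word `I` with its letters reversed. -/
def localizingMatrix {d : ℕ} (c : Word d → ℂ) (k : Fin d) : Matrix (Word d) (Word d) ℂ :=
  Matrix.of fun I J => c (I.reverse ++ k :: J)

/-- The bounded operator `T` on `ℓ²` of the words has the matrix `M` in the standard basis. -/
def HasMatrix {d : ℕ}
    (T : lp (fun _ : Word d => ℂ) 2 →L[ℂ] lp (fun _ : Word d => ℂ) 2)
    (M : Matrix (Word d) (Word d) ℂ) : Prop :=
  ∀ I J, T (lp.single 2 J 1) I = M I J

/-!
The argument compares two descriptions of the derivative of `f`. Evaluating the series at scalar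
tuples `(t, …, t)` with `d < t < d + ε` gives `|c_W| ≤ C t^{-|W|}`. There are only `d^m` words of
length `m`, so the coefficients, and even the family `c_{I x_k J}` over all triples `(I, k, J)`, are
absolutely summable. Hence on the unit ball the series converges absolutely, may be differentiated
term by term, and, once the terms are collected by the letter that is differentiated,
`v^* Df(X)[H] v = ∑_k ∑_{I,J} c_{I^* x_k J} (X^I v)^* H_k (X^J v)` for self-adjoint `X`
(`hasSum_star_dotProduct_wordDeriv`).

If the localizing matrices are positive semidefinite, factoring `H_k = B_k^* B_k` shows that this
is nonnegative for `H ≥ 0`, and integrating along the segment from `X` to `Y` gives matrix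
monotonicity (`re_tsum_wordEval_le`).

Conversely, take `H` to be a rank-one matrix in the `k`-th entry and zero in the others. Then the
right-hand side is the quadratic form of the `x_k`-localizing matrix at the vector
`J ↦ hᵀ X^J v`. Compressing the self-adjoint field operators `l_i + l_i^*` of the full Fock space to
the words of bounded length, scaling them by `s → 0` and adapting `h` to the scaling, one
approximates every finitely supported vector (`exists_tendsto_dotProduct_wordEval`). So
nonnegativity of the derivative on an arbitrarily small ball forces the localizing matrices to be
positive semidefinite (`posSemidef_localizingMatrix`). Both local monotonicity and matrix
monotonicity provide such nonnegativity.

Absolute summability of the entries also yields the operator on `ℓ²`: it is a norm-convergent sum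
of rank-one operators, hence compact.
-/

/-! ### Positive semidefinite matrices over an infinite index set -/

/-- Over `ℂ`, polarization makes Hermitian symmetry a consequence of nonnegativity of the
quadratic form. -/
theorem Matrix.isHermitian_of_forall_sum_nonneg {α : Type*} {M : Matrix α α ℂ}
    (h : ∀ x : α →₀ ℂ, 0 ≤ x.sum fun i xi => x.sum fun j xj => star xi * M i j * xj) :
    M.IsHermitian := by
  classical
  have key : ∀ (i j : α) (a b : ℂ), 0 ≤ star a * M i i * a + star a * M i j * b +
      (star b * M j i * a + star b * M j j * b) := by
    intro i j a b
    have := h (Finsupp.single i a + Finsupp.single j b)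
    rw [Finsupp.sum_add_index' (by simp) (by intros; simp [Finsupp.sum, add_mul,
      Finset.sum_add_distrib])] at this
    rw [Finsupp.sum_single_index (by simp), Finsupp.sum_single_index (by simp)] at this
    rw [Finsupp.sum_add_index' (by simp) (by intros; ring),
      Finsupp.sum_add_index' (by simp) (by intros; ring)] at this
    simpa [Finsupp.sum_single_index] using this
  have im0 := fun i j a b => (Complex.nonneg_iff.1 (key i j a b)).2
  ext i j
  have hi := im0 i i 1 0
  have hj := im0 j j 1 0
  have h1 := im0 i j 1 1
  have h2 := im0 i j 1 Complex.I
  simp at hi hj h1 h2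
  apply Complex.ext <;> simp <;> linarith

/-- A positive semidefinite form stays nonnegative when its arguments are vectors, paired by the
standard inner product: it is the sum of the forms of the coordinates. -/
theorem Matrix.PosSemidef.sum_mul_dotProduct_nonneg {α m : Type*} [Fintype m]
    {M : Matrix α α ℂ} (hM : M.PosSemidef) (y : α → m → ℂ) (S : Finset α) :
    0 ≤ ∑ p ∈ S ×ˢ S, M p.1 p.2 * (star (y p.1) ⬝ᵥ y p.2) := by
  classical
  have h : ∀ a, 0 ≤ ∑ i ∈ S, ∑ j ∈ S, star (y i a) * M i j * y j a := by
    intro a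
    have := hM.2 (Finsupp.indicator S fun i _ => y i a)
    rw [Finsupp.sum_of_support_subset _ (Finsupp.support_indicator_subset _ _) _ (by simp)] at this
    convert this using 1
    refine Finset.sum_congr rfl fun i hi => ?_
    rw [Finsupp.sum_of_support_subset _ (Finsupp.support_indicator_subset _ _) _ (by simp)]
    refine Finset.sum_congr rfl fun j hj => ?_
    simp [hi, hj]
  have h2 := Finset.sum_nonneg fun a (_ : a ∈ Finset.univ) => h a
  convert h2 using 1
  rw [Finset.sum_product, Finset.sum_comm' (s := Finset.univ) (t' := S) (s' := fun _ => Finset.univ)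
    (by simp)]
  refine Finset.sum_congr rfl fun i hi => ?_
  rw [Finset.sum_comm]
  refine Finset.sum_congr rfl fun j hj => ?_
  rw [dotProduct, Finset.mul_sum]
  exact Finset.sum_congr rfl fun a _ => by simp; ring

theorem Matrix.PosSemidef.hasSum_nonneg {α m : Type*} [Fintype m]
    {M : Matrix α α ℂ} (hM : M.PosSemidef) (y : α → m → ℂ) {s : ℂ}
    (hs : HasSum (fun p : α × α => M p.1 p.2 * (star (y p.1) ⬝ᵥ y p.2)) s) : 0 ≤ s := by
  classical
  have h : Filter.Tendsto (fun S : Finset α => S ×ˢ S) Filter.atTop Filter.atTop := by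
    refine Filter.tendsto_atTop.2 fun T => ?_
    filter_upwards [Filter.eventually_ge_atTop (T.image Prod.fst ∪ T.image Prod.snd)] with S hS p hp
    exact Finset.mem_product.2
      ⟨hS (Finset.mem_union_left _ (Finset.mem_image_of_mem _ hp)),
        hS (Finset.mem_union_right _ (Finset.mem_image_of_mem _ hp))⟩
  -- The squares `S ×ˢ S` are cofinal among the finite sets of pairs.
  exact ge_of_tendsto' (hs.comp h) fun S => hM.sum_mul_dotProduct_nonneg y S

/-! ### Decay of the coefficients -/

theorem summable_pow_length {d : ℕ} {q : ℝ} (hq : 0 ≤ q) (hdq : d * q < 1) :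
    Summable fun I : Word d => q ^ I.length := by
  have : ∀ n : ℕ, Finite {I : Word d // I.length = n} := fun n =>
    inferInstanceAs (Finite (List.Vector (Fin d) n))
  have hcard : ∀ n, Nat.card {I : Word d // I.length = n} = d ^ n := fun n => by
    have h := Nat.card_eq_fintype_card (α := List.Vector (Fin d) n)
    rwa [card_vector, Fintype.card_fin] at h
  rw [← (Equiv.sigmaFiberEquiv (List.length : Word d → ℕ)).summable_iff,
    summable_sigma_of_nonneg fun _ => by simp; positivity]
  have hval : ∀ n, ∀ I : {I : Word d // I.length = n},
      ((fun I : Word d => q ^ I.length) ∘ (Equiv.sigmaFiberEquiv (List.length : Word d → ℕ)))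
        ⟨n, I⟩ = q ^ n :=
    fun n I => by simp [Equiv.sigmaFiberEquiv, I.2]
  refine ⟨fun n => .of_finite, ?_⟩
  simp only [hval, tsum_const, hcard, nsmul_eq_mul, Nat.cast_pow, ← mul_pow]
  exact summable_geometric_of_lt_one (by positivity) hdq

/-- At the scalar tuple `(t, …, t)` the terms of the convergent series tend to zero, so they are
bounded. -/
theorem HasPowerSeriesOn.exists_norm_coeff_mul_pow_le {d : ℕ} {r : ℝ} {e : ℕ ≃ Word d}
    {c : Word d → ℂ} {f : GradedFun d} (h : HasPowerSeriesOn e c (realBall d r) f)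
    {t : ℝ} (ht : 0 ≤ t) (htr : t < r) : ∃ C, ∀ W, ‖c W‖ * t ^ W.length ≤ C := by
  let X : MatTuple d 1 := fun _ => (t : ℂ) • 1
  have hX : X ∈ realBall d r 1 := by
    refine ⟨fun i => by simp [X, Matrix.IsHermitian], lt_of_le_of_lt ?_ htr⟩
    refine (pi_norm_le_iff_of_nonneg ht).2 fun i => ?_
    simp [X, norm_smul, abs_of_nonneg ht]
  have hW : ∀ W, wordEval X W = ((t : ℂ) ^ W.length) • 1 := by
    intro W
    rw [wordEval, List.map_const', List.prod_replicate, smul_pow, one_pow]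
  have hlim := h 1 X hX
  have h0 : Filter.Tendsto (fun N => c (e N) • wordEval X (e N)) Filter.atTop (𝓝 0) := by
    have := ((Filter.tendsto_add_atTop_iff_nat 1).2 hlim).sub hlim
    simpa [Finset.sum_range_succ] using this
  obtain ⟨C, hC⟩ := (Metric.isBounded_range_of_tendsto _ h0).exists_norm_le
  refine ⟨C, fun W => ?_⟩
  have := hC _ ⟨e.symm W, rfl⟩
  simpa [hW, norm_smul, abs_of_nonneg ht] using this

theorem summable_coeff {d : ℕ} {c : Word d → ℂ} {C t : ℝ} (ht : 0 < t) (hdt : d < t)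
    (hc : ∀ W, ‖c W‖ * t ^ W.length ≤ C) : Summable fun W => ‖c W‖ := by
  have hs := (summable_pow_length (d := d) (inv_nonneg.2 ht.le)
    (by rwa [← div_eq_mul_inv, div_lt_one ht])).mul_left C
  refine hs.of_nonneg_of_le (fun _ => norm_nonneg _) fun W => ?_
  rw [inv_pow, ← div_eq_mul_inv, le_div_iff₀ (by positivity)]
  exact hc W

theorem summable_coeff_append_cons {d : ℕ} {c : Word d → ℂ} {C t : ℝ} (ht : 0 < t) (hdt : d < t)
    (hc : ∀ W, ‖c W‖ * t ^ W.length ≤ C) :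
    Summable fun p : Fin d × Word d × Word d => ‖c (p.2.1 ++ p.1 :: p.2.2)‖ := by
  have hq := summable_pow_length (d := d) (inv_nonneg.2 ht.le)
    (by rwa [← div_eq_mul_inv, div_lt_one ht])
  have hs := (hq.mul_of_nonneg hq (fun _ => by simp; positivity) fun _ => by simp; positivity)
  have hs2 := (Summable.of_finite (f := fun _ : Fin d => C / t)).norm.mul_of_nonneg hs
    (fun _ => norm_nonneg _) fun _ => by simp; positivity
  refine hs2.of_nonneg_of_le (fun _ => norm_nonneg _) fun ⟨k, I, J⟩ => ?_
  have h1 := hc (I ++ k :: J)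
  simp only [List.length_append, List.length_cons] at h1
  refine le_trans ?_ (mul_le_mul_of_nonneg_right (Real.le_norm_self _) (by positivity))
  rw [inv_pow, inv_pow, ← mul_inv, div_mul_eq_mul_div, ← div_eq_mul_inv, div_div,
    le_div_iff₀ (by positivity)]
  exact (le_of_eq (by ring)).trans h1

/-! ### Monomials and their derivatives -/

/-- Choosing a letter position in a word amounts to splitting the word as `I x_k J`. -/
def splitEquiv (d : ℕ) : (Fin d × Word d × Word d) ≃ Σ W : Word d, Fin W.length where
  toFun p := ⟨p.2.1 ++ p.1 :: p.2.2, p.2.1.length, by simp⟩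
  invFun q := (q.1[q.2], q.1.take q.2, q.1.drop (q.2 + 1))
  left_inv := by
    rintro ⟨k, I, J⟩
    simp
  right_inv := by
    rintro ⟨W, p⟩
    have h : W.take p ++ W[p] :: W.drop (p + 1) = W := by simp
    refine Sigma.ext h ?_
    refine (Fin.heq_ext_iff (by simp)).2 ?_
    simp [p.2.le]

theorem norm_wordEval_le_one {d n : ℕ} {X : MatTuple d n} (hX : ‖X‖ ≤ 1) (W : Word d) :
    ‖wordEval X W‖ ≤ 1 := by
  induction W with
  | nil =>
    simp only [wordEval, List.map_nil, List.prod_nil]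
    rcases isEmpty_or_nonempty (Fin n) with h | h
    · rw [Subsingleton.elim (1 : Matrix (Fin n) (Fin n) ℂ) 0]; simp
    · exact CStarRing.norm_one.le
  | cons k W ih =>
    rw [wordEval, List.map_cons, List.prod_cons]
    exact (norm_mul_le _ _).trans
      (mul_le_one₀ ((norm_le_pi_norm X k).trans hX) (norm_nonneg _) ih)

theorem wordEval_reverse {d n : ℕ} {X : MatTuple d n} (hX : IsSelfAdjointTuple X) (W : Word d) :
    wordEval X W.reverse = (wordEval X W).conjTranspose := by
  induction W with
  | nil => simp [wordEval]
  | cons k W ih =>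
    have h : wordEval X (k :: W).reverse = wordEval X W.reverse * X k := by simp [wordEval]
    rw [h, ih]
    simp [wordEval, (hX k).eq]

/-- The directional derivative of the monomial `X^W` at `X` in the direction `H`. -/
def wordDeriv {d n : ℕ} (X H : MatTuple d n) (W : Word d) : Matrix (Fin n) (Fin n) ℂ :=
  ∑ p : Fin W.length, wordEval X (W.take p) * H W[p] * wordEval X (W.drop (p + 1))

theorem hasDerivAt_wordEval {d n : ℕ} (X H : MatTuple d n) (W : Word d) (t : ℝ) :
    HasDerivAt (fun s : ℝ => wordEval (X + s • H) W) (wordDeriv (X + t • H) H W) t := by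
  induction W with
  | nil => simpa [wordEval, wordDeriv] using hasDerivAt_const t _
  | cons k W ih =>
    have h1 : HasDerivAt (fun s : ℝ => (X + s • H) k) (H k) t := by
      simpa using ((hasDerivAt_id t).smul_const (H k)).const_add (X k)
    have h2 : wordDeriv (X + t • H) H (k :: W) =
        H k * wordEval (X + t • H) W + (X + t • H) k * wordDeriv (X + t • H) H W := by
      simp only [wordDeriv, List.length_cons, Fin.sum_univ_succ, Finset.mul_sum]
      simp [wordEval, mul_assoc]
    rw [h2]
    exact h1.mul ih

theorem norm_wordDeriv_le {d n : ℕ} {X : MatTuple d n} (hX : ‖X‖ ≤ 1) (H : MatTuple d n)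
    (W : Word d) : ‖wordDeriv X H W‖ ≤ W.length * ‖H‖ := by
  refine (norm_sum_le_of_le _ fun p _ => ?_).trans_eq (b := ∑ p : Fin W.length, ‖H‖) (by simp)
  calc _ ≤ ‖wordEval X (W.take p)‖ * ‖H W[p]‖ * ‖wordEval X (W.drop (p + 1))‖ := norm_mul₃_le
    _ ≤ 1 * ‖H‖ * 1 := by
      gcongr
      exacts [norm_wordEval_le_one hX _, norm_le_pi_norm _ _, norm_wordEval_le_one hX _]
    _ = ‖H‖ := by ring

/-! ### The derivative of the series in terms of the localizing matrices -/

theorem hasDerivAt_tsum_wordEval {d n : ℕ} {c : Word d → ℂ} (hc : Summable fun W => ‖c W‖)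
    (hc' : Summable fun p : Fin d × Word d × Word d => ‖c (p.2.1 ++ p.1 :: p.2.2)‖)
    {X H : MatTuple d n} {S : Set ℝ} (hS : IsOpen S) (hS' : IsPreconnected S)
    (hX : ∀ t ∈ S, ‖X + t • H‖ ≤ 1) {t : ℝ} (ht : t ∈ S) :
    HasDerivAt (fun s : ℝ => ∑' W, c W • wordEval (X + s • H) W)
      (∑' W, c W • wordDeriv (X + t • H) H W) t := by
  -- Each coefficient `c_W` occurs `|W|` times in the summable family over the splittings of words.
  have hlen : Summable fun W : Word d => ‖c W‖ * (W.length * ‖H‖) := by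
    have h := ((splitEquiv d).symm.summable_iff.2 hc').sigma
    refine (h.mul_right ‖H‖).congr fun W => ?_
    have h2 : ∀ p : Fin W.length, W.take p ++ W[p] :: W.drop (p + 1) = W := by simp
    simp only [Function.comp_apply, splitEquiv, Equiv.coe_fn_symm_mk, h2]
    simp
    ring
  refine hasDerivAt_tsum_of_isPreconnected hlen hS hS'
    (fun W s _ => (hasDerivAt_wordEval X H W s).const_smul (c W)) (fun W s hs => ?_) ht
    (Summable.of_norm_bounded hc fun W => ?_) ht
  · rw [norm_smul]
    gcongr
    exact norm_wordDeriv_le (hX s hs) H W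
  · rw [Pi.smul_apply, norm_smul]
    exact mul_le_of_le_one_right (norm_nonneg _) (norm_wordEval_le_one (hX t ht) W)

/-- Collecting the terms of the differentiated series by the differentiated letter turns the
derivative into a sum of the localizing matrices. -/
theorem hasSum_wordDeriv {d n : ℕ} {c : Word d → ℂ}
    (hc' : Summable fun p : Fin d × Word d × Word d => ‖c (p.2.1 ++ p.1 :: p.2.2)‖)
    {X : MatTuple d n} (hX : IsSelfAdjointTuple X) (hX1 : ‖X‖ ≤ 1) (H : MatTuple d n) :
    HasSum (fun p : Fin d × Word d × Word d => localizingMatrix c p.1 p.2.1 p.2.2 •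
      ((wordEval X p.2.1).conjTranspose * H p.1 * wordEval X p.2.2))
      (∑' W, c W • wordDeriv X H W) := by
  have hsum : Summable fun p : Fin d × Word d × Word d => c (p.2.1 ++ p.1 :: p.2.2) •
      (wordEval X p.2.1 * H p.1 * wordEval X p.2.2) := by
    refine Summable.of_norm_bounded (hc'.mul_right ‖H‖) fun p => ?_
    rw [norm_smul]
    gcongr
    calc _ ≤ ‖wordEval X p.2.1‖ * ‖H p.1‖ * ‖wordEval X p.2.2‖ := norm_mul₃_le
      _ ≤ 1 * ‖H‖ * 1 := by
        gcongr
        exacts [norm_wordEval_le_one hX1 _, norm_le_pi_norm _ _, norm_wordEval_le_one hX1 _]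
      _ = ‖H‖ := by ring
  have h1 : HasSum (fun p : Fin d × Word d × Word d => c (p.2.1 ++ p.1 :: p.2.2) •
      (wordEval X p.2.1 * H p.1 * wordEval X p.2.2)) (∑' W, c W • wordDeriv X H W) := by
    rw [hsum.hasSum_iff, ← (splitEquiv d).symm.tsum_eq]
    refine ((splitEquiv d).symm.summable_iff.2 hsum).tsum_sigma.trans ?_
    refine tsum_congr fun W => ?_
    have h2 : ∀ p : Fin W.length, W.take p ++ W[p] :: W.drop (p + 1) = W := by simp
    simp only [Function.comp_apply, splitEquiv, Equiv.coe_fn_symm_mk, h2, wordDeriv,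
      Finset.smul_sum, tsum_fintype]
  -- The rows of the localizing matrix are indexed by the reversed words.
  let E : (Fin d × Word d × Word d) ≃ (Fin d × Word d × Word d) :=
    (Equiv.refl _).prodCongr
      ((Function.Involutive.toPerm _ List.reverse_involutive).prodCongr (Equiv.refl _))
  convert E.hasSum_iff.2 h1 using 1
  ext1 p
  simp [E, localizingMatrix, wordEval_reverse hX]

theorem hasSum_star_dotProduct_wordDeriv {d n : ℕ} {c : Word d → ℂ}
    (hc' : Summable fun p : Fin d × Word d × Word d => ‖c (p.2.1 ++ p.1 :: p.2.2)‖)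
    {X : MatTuple d n} (hX : IsSelfAdjointTuple X) (hX1 : ‖X‖ ≤ 1)
    (B : MatTuple d n) (v : Fin n → ℂ) :
    HasSum (fun p : Fin d × Word d × Word d => localizingMatrix c p.1 p.2.1 p.2.2 *
      (star ((B p.1).mulVec ((wordEval X p.2.1).mulVec v)) ⬝ᵥ
        (B p.1).mulVec ((wordEval X p.2.2).mulVec v)))
      (star v ⬝ᵥ (∑' W, c W •
        wordDeriv X (fun k => (B k).conjTranspose * B k) W).mulVec v) := by
  let φ : Matrix (Fin n) (Fin n) ℂ →+ ℂ :=
    { toFun := fun A => star v ⬝ᵥ A.mulVec v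
      map_zero' := by simp
      map_add' := by simp [Matrix.add_mulVec, dotProduct_add] }
  have hφ : Continuous φ := by
    change Continuous fun A : Matrix (Fin n) (Fin n) ℂ => star v ⬝ᵥ A.mulVec v
    fun_prop
  refine ((hasSum_wordDeriv hc' hX hX1 fun k => (B k).conjTranspose * B k).map φ hφ).congr_fun ?_
  intro p
  change _ = star v ⬝ᵥ (_ • _ : Matrix (Fin n) (Fin n) ℂ).mulVec v
  rw [Matrix.smul_mulVec, dotProduct_smul, smul_eq_mul, Matrix.star_mulVec, Matrix.star_mulVec]
  simp only [Matrix.dotProduct_mulVec, Matrix.vecMul_vecMul, Matrix.mul_assoc]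

open scoped MatrixOrder in
theorem Matrix.PosSemidef.exists_eq_conjTranspose_mul_self {n : ℕ}
    {A : Matrix (Fin n) (Fin n) ℂ} (hA : A.PosSemidef) : ∃ B, A = B.conjTranspose * B := by
  obtain ⟨B, hB⟩ := CStarAlgebra.nonneg_iff_eq_star_mul_self.1 hA.nonneg
  exact ⟨B, hB⟩

theorem star_dotProduct_tsum_wordDeriv_nonneg {d n : ℕ} {c : Word d → ℂ}
    (hc' : Summable fun p : Fin d × Word d × Word d => ‖c (p.2.1 ++ p.1 :: p.2.2)‖)
    (hpos : ∀ k, (localizingMatrix c k).PosSemidef)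
    {X : MatTuple d n} (hX : IsSelfAdjointTuple X) (hX1 : ‖X‖ ≤ 1)
    {H : MatTuple d n} (hH : ∀ k, (H k).PosSemidef) (v : Fin n → ℂ) :
    0 ≤ star v ⬝ᵥ (∑' W, c W • wordDeriv X H W).mulVec v := by
  choose B hB using fun k => (hH k).exists_eq_conjTranspose_mul_self
  obtain rfl : H = fun k => (B k).conjTranspose * B k := funext hB
  have hs := hasSum_star_dotProduct_wordDeriv hc' hX hX1 B v
  have h := hs.prod_fiberwise fun k => (hs.summable.prod_factor k).hasSum
  refine h.nonneg fun k => ?_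
  exact (hpos k).hasSum_nonneg (fun I => (B k).mulVec ((wordEval X I).mulVec v))
    (hs.summable.prod_factor k).hasSum

theorem norm_add_smul_sub_le {E : Type*} [SeminormedAddCommGroup E] [NormedSpace ℝ E]
    {x y : E} {r : ℝ} (hx : ‖x‖ ≤ r) (hy : ‖y‖ ≤ r) {t : ℝ} (ht : t ∈ Set.Icc (0 : ℝ) 1) :
    ‖x + t • (y - x)‖ ≤ r := by
  simpa using (convex_closedBall (0 : E) r).add_smul_sub_mem (by simpa using hx)
    (by simpa using hy) ht

theorem isSelfAdjointTuple_add_smul {d n : ℕ} {X H : MatTuple d n} (hX : IsSelfAdjointTuple X)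
    (hH : IsSelfAdjointTuple H) (t : ℝ) : IsSelfAdjointTuple (X + t • H) := fun k =>
  (hX k).add ((hH k).smul (IsSelfAdjoint.all t))

/-- If all localizing matrices are positive semidefinite, then so is the derivative in positive
semidefinite directions, and integrating along segments gives monotonicity. -/
theorem re_tsum_wordEval_le {d n : ℕ} {c : Word d → ℂ} (hc : Summable fun W => ‖c W‖)
    (hc' : Summable fun p : Fin d × Word d × Word d => ‖c (p.2.1 ++ p.1 :: p.2.2)‖)
    (hpos : ∀ k, (localizingMatrix c k).PosSemidef)
    {X Y : MatTuple d n} (hX : IsSelfAdjointTuple X) (hX1 : ‖X‖ ≤ 1) (hY1 : ‖Y‖ ≤ 1)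
    (hXY : ∀ k, (Y k - X k).PosSemidef) (v : Fin n → ℂ) :
    (star v ⬝ᵥ (∑' W, c W • wordEval X W).mulVec v).re ≤
      (star v ⬝ᵥ (∑' W, c W • wordEval Y W).mulVec v).re := by
  let F : ℝ → Matrix (Fin n) (Fin n) ℂ := fun t => ∑' W, c W • wordEval (X + t • (Y - X)) W
  let φ : Matrix (Fin n) (Fin n) ℂ →L[ℝ] ℝ :=
    { toFun := fun A => (star v ⬝ᵥ A.mulVec v).re
      map_add' := by simp [Matrix.add_mulVec, dotProduct_add]
      map_smul' := by simp [Matrix.smul_mulVec, dotProduct_smul]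
      cont := by fun_prop }
  have hnorm : ∀ t ∈ Set.Icc (0 : ℝ) 1, ‖X + t • (Y - X)‖ ≤ 1 := fun t ht =>
    norm_add_smul_sub_le hX1 hY1 ht
  have hcont : ContinuousOn F (Set.Icc 0 1) := by
    refine continuousOn_tsum (fun W => ?_) hc fun W t ht => ?_
    · exact fun t _ => ((hasDerivAt_wordEval X (Y - X) W t).const_smul
        (c W)).continuousAt.continuousWithinAt
    · rw [norm_smul]
      exact mul_le_of_le_one_right (norm_nonneg _) (norm_wordEval_le_one (hnorm t ht) W)
  have hder : ∀ t ∈ Set.Ioo (0 : ℝ) 1, HasDerivAt F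
      (∑' W, c W • wordDeriv (X + t • (Y - X)) (Y - X) W) t := fun t ht =>
    hasDerivAt_tsum_wordEval hc hc' isOpen_Ioo isPreconnected_Ioo
      (fun s hs => hnorm s (Set.Ioo_subset_Icc_self hs)) ht
  have hmono : MonotoneOn (fun t => φ (F t)) (Set.Icc 0 1) := by
    refine monotoneOn_of_hasDerivWithinAt_nonneg (convex_Icc 0 1)
      (φ.continuous.comp_continuousOn hcont)
      (f' := fun t => φ (∑' W, c W • wordDeriv (X + t • (Y - X)) (Y - X) W)) ?_ ?_
    · intro t ht
      rw [interior_Icc] at ht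
      exact (φ.hasFDerivAt.comp_hasDerivAt t (hder t ht)).hasDerivWithinAt
    · intro t ht
      rw [interior_Icc] at ht
      exact (Complex.nonneg_iff.1 (star_dotProduct_tsum_wordDeriv_nonneg hc' hpos
        (isSelfAdjointTuple_add_smul hX (fun k => (hXY k).1) t)
        (hnorm t (Set.Ioo_subset_Icc_self ht)) hXY v)).1
  have := hmono (by simp) (by simp) zero_le_one
  simpa [F, φ] using this

/-! ### The operator of a matrix with summable entries -/

section RankOneSeries

open InnerProductSpace

variable {E : Type*} [NormedAddCommGroup E] [InnerProductSpace ℂ E]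

theorem isCompactOperator_rankOne (x y : E) : IsCompactOperator (rankOne ℂ x y) :=
  (isCompactOperator_of_locallyCompactSpace_dom (innerSL ℂ y)).clm_comp
    (ContinuousLinearMap.toSpanSingleton ℂ x)

/-- A positive semidefinite matrix with absolutely summable entries, combined with an orthonormal
family of vectors, gives a norm-convergent sum of rank-one operators, which is compact and
positive. -/
theorem exists_isPositive_isCompactOperator [CompleteSpace E] {α : Type*} [DecidableEq α]
    {M : Matrix α α ℂ} (hM : M.PosSemidef) (hs : Summable fun p : α × α => ‖M p.1 p.2‖)
    {b : α → E} (hb : Orthonormal ℂ b) :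
    ∃ T : E →L[ℂ] E, (∀ i j, inner ℂ (b i) (T (b j)) = M i j) ∧ T.IsPositive ∧
      IsCompactOperator T := by
  have hR : Summable fun p : α × α => M p.1 p.2 • rankOne ℂ (b p.1) (b p.2) := by
    refine Summable.of_norm_bounded hs fun p => ?_
    simp [norm_smul, hb.1]
  obtain ⟨T, hT⟩ := hR
  have hx : ∀ z x, HasSum (fun p : α × α => M p.1 p.2 * (inner ℂ z (b p.1) * inner ℂ (b p.2) x))
      (inner ℂ z (T x)) := fun z x => by
    have h := (innerSL ℂ z).hasSum ((ContinuousLinearMap.apply ℂ E x).hasSum hT)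
    refine h.congr_fun fun p => ?_
    simp [mul_comm]
  refine ⟨T, fun i j => ?_, ?_, ?_⟩
  · refine (hx (b i) (b j)).unique ((hasSum_ite_eq (i, j) (M i j)).congr_fun fun p => ?_)
    obtain ⟨i', j'⟩ := p
    simp only [orthonormal_iff_ite.1 hb, Prod.mk.injEq]
    by_cases h1 : i' = i <;> by_cases h2 : j' = j <;> simp [h1, h2, eq_comm (a := i)]
  · rw [ContinuousLinearMap.isPositive_iff_complex]
    intro x
    have h := hM.hasSum_nonneg (fun i (_ : Unit) => inner ℂ (b i) x)
      ((hx x x).congr_fun fun p => by simp [dotProduct])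
    have h0 := Complex.nonneg_iff.1 h
    rw [← inner_conj_symm]
    generalize inner ℂ x (T x) = w at h0
    exact ⟨Complex.ext (by simp) (by simp [← h0.2]), by simpa using h0.1⟩
  · exact isCompactOperator_of_tendsto hT (.of_forall fun S =>
      Submodule.sum_mem (compactOperator (RingHom.id ℂ) E E) fun p _ =>
        (isCompactOperator_rankOne _ _).smul (M p.1 p.2))

end RankOneSeries

theorem orthonormal_lp_single (α : Type*) [DecidableEq α] :
    Orthonormal ℂ fun i : α => (lp.single 2 i (1 : ℂ) : lp (fun _ : α => ℂ) 2) := by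
  rw [orthonormal_iff_ite]
  intro i j
  simp [lp.inner_single_left, lp.single_apply, Pi.single_apply]

theorem exists_hasMatrix_isPositive_isCompactOperator {d : ℕ} {M : Matrix (Word d) (Word d) ℂ}
    (hM : M.PosSemidef) (hs : Summable fun p : Word d × Word d => ‖M p.1 p.2‖) :
    ∃ T : lp (fun _ : Word d => ℂ) 2 →L[ℂ] lp (fun _ : Word d => ℂ) 2,
      HasMatrix T M ∧ T.IsPositive ∧ IsCompactOperator T := by
  obtain ⟨T, h1, h2, h3⟩ := exists_isPositive_isCompactOperator hM hs (orthonormal_lp_single _)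
  refine ⟨T, fun I J => ?_, h2, h3⟩
  rw [← h1 I J, lp.inner_single_left]
  simp

/-! ### Truncated Fock tuples -/

/-- The tuple of truncated field operators `l_i + l_i^*` on the span of the basis vectors
`e_a`, which are labelled by the words `g a`: here `l_i` prepends the letter `x_i` to a word, when
the result is still a label. -/
noncomputable def fockTuple {d n : ℕ} (g : Fin n → Word d) : MatTuple d n := fun i =>
  Matrix.of fun a b => if g a = i :: g b ∨ g b = i :: g a then 1 else 0

theorem isSelfAdjointTuple_fockTuple {d n : ℕ} (g : Fin n → Word d) :
    IsSelfAdjointTuple (fockTuple g) := fun i => by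
  ext a b
  simp only [fockTuple, Matrix.conjTranspose_apply, Matrix.of_apply, or_comm (a := g b = _)]
  split_ifs <;> simp

/-- Column `z`, labelled by the empty word, of a monomial: starting from the empty word, fewer than
`|g a|` letters do not reach `g a`, and `|g a|` letters reach it only if they spell it. -/
theorem wordEval_fockTuple_apply {d n : ℕ} {g : Fin n → Word d} (hg : Function.Injective g)
    (htail : ∀ a i W, g a = i :: W → ∃ b, g b = W) {z : Fin n} (hz : g z = []) (J : Word d)
    (a : Fin n) (ha : J.length ≤ (g a).length) :
    wordEval (fockTuple g) J a z = if g a = J then 1 else 0 := by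
  induction J generalizing a with
  | nil =>
    have h : g a = [] ↔ a = z := by rw [← hz, hg.eq_iff]
    simp [wordEval, Matrix.one_apply, h]
  | cons i J ih =>
    rw [List.length_cons] at ha
    have h1 : wordEval (fockTuple g) (i :: J) a z =
        ∑ b, fockTuple g i a b * wordEval (fockTuple g) J b z := by
      simp [wordEval, Matrix.mul_apply]
    have h2 : ∀ b, fockTuple g i a b * wordEval (fockTuple g) J b z =
        if g a = i :: g b ∧ g b = J then 1 else 0 := by
      intro b
      simp only [fockTuple, Matrix.of_apply]
      by_cases hab : g a = i :: g b
      · rw [ih b (by rw [hab, List.length_cons] at ha; omega)]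
        simp [hab]
      · by_cases hba : g b = i :: g a
        · have hl := congrArg List.length hba
          rw [List.length_cons] at hl
          rw [ih b (by omega), if_neg (c := g b = J) (by rintro rfl; omega)]
          simp [hab]
        · simp [hab, hba]
    rw [h1, Finset.sum_congr rfl fun b _ => h2 b]
    by_cases h : g a = i :: J
    · obtain ⟨b, hb⟩ := htail a i J h
      rw [Finset.sum_eq_single b]
      · simp [h, hb]
      · intro b' _ hb'
        rw [if_neg]
        rintro ⟨-, h'⟩
        exact hb' (hg (h'.trans hb.symm))
      · simp
    · rw [if_neg h]
      refine Finset.sum_eq_zero fun b _ => if_neg ?_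
      rintro ⟨h', rfl⟩
      exact h h'

theorem exists_words_length_le (d N : ℕ) : ∃ (n : ℕ) (g : Fin n → Word d),
    Function.Injective g ∧ ∀ W : Word d, W.length ≤ N ↔ ∃ a, g a = W := by
  have hfin : Finite {W : Word d // W.length ≤ N} := List.finite_length_le _ _
  obtain ⟨n, ⟨φ⟩⟩ := Finite.exists_equiv_fin {W : Word d // W.length ≤ N}
  refine ⟨n, fun a => (φ.symm a).1, Subtype.val_injective.comp φ.symm.injective, fun W => ?_⟩
  exact ⟨fun h => ⟨φ ⟨W, h⟩, by simp⟩, fun ⟨a, ha⟩ => ha ▸ (φ.symm a).2⟩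

/-! ### Positivity of the derivative forces positivity of the localizing matrices -/

theorem wordEval_smul {d n : ℕ} (s : ℝ) (X : MatTuple d n) (J : Word d) :
    wordEval (s • X) J = s ^ J.length • wordEval X J := by
  induction J with
  | nil => simp [wordEval]
  | cons k J ih =>
    have h : ∀ Y : MatTuple d n, wordEval Y (k :: J) = Y k * wordEval Y J := fun Y => by
      simp [wordEval]
    rw [h, h, ih, Pi.smul_apply, smul_mul_smul_comm, List.length_cons, pow_succ']

theorem norm_apply_le_l2_opNorm {n : ℕ} (A : Matrix (Fin n) (Fin n) ℂ) (a b : Fin n) :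
    ‖A a b‖ ≤ ‖A‖ := by
  have h1 := Matrix.l2_opNorm_mulVec A (EuclideanSpace.single b 1)
  have h2 := PiLp.norm_apply_le (WithLp.toLp 2 (A.mulVec (EuclideanSpace.single b (1 : ℂ)))) a
  simpa using h2.trans h1

/-- Every finitely supported vector `x` on the words is the pointwise limit, as `s → 0`, of
uniformly bounded vectors of the form `J ↦ h(s)ᵀ (sX)^J v`. Here `X` is a normalized truncated
Fock tuple, `v` the vacuum vector, and `h(s)` compensates the factor `s^{|J|}` on each label. -/
theorem exists_tendsto_dotProduct_wordEval {d : ℕ} (x : Word d →₀ ℂ) :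
    ∃ (n : ℕ) (X : MatTuple d n) (v : Fin n → ℂ) (h : ℝ → Fin n → ℂ) (K : ℝ),
      IsSelfAdjointTuple X ∧ ‖X‖ ≤ 1 ∧
      (∀ s ∈ Set.Ioc (0 : ℝ) 1, ∀ J, ‖h s ⬝ᵥ (wordEval (s • X) J).mulVec v‖ ≤ K) ∧
      ∀ J, Filter.Tendsto (fun s => h s ⬝ᵥ (wordEval (s • X) J).mulVec v) (𝓝[>] 0)
        (𝓝 (x J)) := by
  obtain ⟨n, g, hg, hN⟩ := exists_words_length_le d (x.support.sup List.length)
  obtain ⟨z, hz⟩ := (hN []).1 (by simp)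
  have htail : ∀ a i W, g a = i :: W → ∃ b, g b = W := fun a i W h => (hN W).1 <| by
    have := (hN (g a)).2 ⟨a, rfl⟩
    rw [h, List.length_cons] at this
    omega
  have hsurj : ∀ W, x W ≠ 0 → ∃ a, g a = W := fun W hW => (hN W).1 <|
    Finset.le_sup (f := List.length) (Finsupp.mem_support_iff.2 hW)
  set R : ℝ := max 1 ‖(fockTuple g : MatTuple d n)‖
  have hR0 : 0 < R := lt_of_lt_of_le one_pos (le_max_left _ _)
  let X : MatTuple d n := R⁻¹ • fockTuple g
  have hX1 : ‖X‖ ≤ 1 := by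
    rw [norm_smul, norm_inv, Real.norm_of_nonneg hR0.le, inv_mul_le_iff₀ hR0, mul_one]
    exact le_max_right _ _
  let h : ℝ → Fin n → ℂ := fun s a => x (g a) * (R ^ (g a).length * (s ^ (g a).length)⁻¹ : ℝ)
  have hval : ∀ s J, h s ⬝ᵥ (wordEval (s • X) J).mulVec (Pi.single z 1) =
      ∑ a, x (g a) * (R ^ (g a).length : ℝ) *
        ((s ^ J.length * (s ^ (g a).length)⁻¹ : ℝ) * wordEval X J a z) := by
    intro s J
    simp only [dotProduct, Matrix.mulVec_single_one, Matrix.col_apply, wordEval_smul s,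
      Matrix.smul_apply, Complex.real_smul, h]
    refine Finset.sum_congr rfl fun a _ => ?_
    push_cast
    ring
  -- Below the length of the label nothing depends on `s`.
  have hlow : ∀ s : ℝ, 0 < s → ∀ (J : Word d) a, J.length ≤ (g a).length →
      (s ^ J.length * (s ^ (g a).length)⁻¹ : ℝ) * wordEval X J a z =
        if g a = J then ((R ^ (g a).length : ℝ) : ℂ)⁻¹ else 0 := by
    intro s hs J a hJ
    rw [show wordEval X J = _ from wordEval_smul R⁻¹ (fockTuple g) J, Matrix.smul_apply,
      wordEval_fockTuple_apply hg htail hz J a hJ]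
    split_ifs with hga
    · subst hga
      rw [mul_inv_cancel₀ (by positivity)]
      simp
    · simp
  have hhigh : ∀ s : ℝ, 0 < s → ∀ (J : Word d) a, (g a).length < J.length →
      (s ^ J.length * (s ^ (g a).length)⁻¹ : ℝ) = s ^ (J.length - (g a).length) := by
    intro s hs J a hJ
    rw [pow_sub₀ s hs.ne' hJ.le]
  refine ⟨n, X, Pi.single z 1, h, ∑ a, ‖x (g a) * (R ^ (g a).length : ℝ)‖, ?_, hX1, ?_, ?_⟩
  · exact fun i => (isSelfAdjointTuple_fockTuple g i).smul (IsSelfAdjoint.all R⁻¹)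
  · rintro s ⟨hs0, hs1⟩ J
    rw [hval]
    refine norm_sum_le_of_le _ fun a _ => ?_
    rw [norm_mul]
    refine mul_le_of_le_one_right (norm_nonneg _) ?_
    rcases le_or_gt J.length (g a).length with hJ | hJ
    · rw [hlow s hs0 J a hJ]
      split_ifs
      · rw [norm_inv, Complex.norm_real, Real.norm_of_nonneg (by positivity)]
        exact inv_le_one_of_one_le₀ (one_le_pow₀ (le_max_left _ _))
      · simp
    · rw [hhigh s hs0 J a hJ, norm_mul, Complex.norm_real, Real.norm_of_nonneg (by positivity)]
      exact mul_le_one₀ (pow_le_one₀ hs0.le hs1) (norm_nonneg _)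
        ((norm_apply_le_l2_opNorm _ _ _).trans (norm_wordEval_le_one hX1 J))
  · intro J
    have hx : x J = ∑ a, x (g a) * (R ^ (g a).length : ℝ) *
        if g a = J then ((R ^ (g a).length : ℝ) : ℂ)⁻¹ else 0 := by
      have hRne : ∀ m : ℕ, ((R ^ m : ℝ) : ℂ) ≠ 0 := fun m => by
        exact_mod_cast (pow_pos hR0 m).ne'
      by_cases hJ : ∃ a, g a = J
      · obtain ⟨a, rfl⟩ := hJ
        rw [Finset.sum_eq_single a]
        · rw [if_pos rfl, mul_inv_cancel_right₀ (hRne _)]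
        · intro b _ hb
          rw [if_neg (hg.ne hb), mul_zero]
        · simp
      · rw [Finset.sum_eq_zero, not_not.1 (mt (hsurj J) hJ)]
        intro a _
        rw [if_neg fun h => hJ ⟨a, h⟩, mul_zero]
    simp only [hval]
    rw [hx]
    refine tendsto_finsetSum _ fun a _ => Filter.Tendsto.const_mul _ ?_
    rcases le_or_gt J.length (g a).length with hJ | hJ
    · refine tendsto_const_nhds.congr' ?_
      filter_upwards [self_mem_nhdsWithin] with s hs
      exact (hlow s hs J a hJ).symm
    · rw [if_neg (by rintro rfl; exact lt_irrefl _ hJ)]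
      have h0 : Filter.Tendsto
          (fun s : ℝ => ((s ^ (J.length - (g a).length) : ℝ) : ℂ) * wordEval X J a z)
          (𝓝[>] 0) (𝓝 0) := by
        have hc : Continuous
            (fun s : ℝ => ((s ^ (J.length - (g a).length) : ℝ) : ℂ) * wordEval X J a z) := by
          fun_prop
        refine (hc.tendsto' 0 0 ?_).mono_left nhdsWithin_le_nhds
        simp [zero_pow (Nat.sub_ne_zero_of_lt hJ)]
      refine h0.congr' ?_
      filter_upwards [self_mem_nhdsWithin] with s hs
      rw [hhigh s hs J a hJ]

/-- If the derivative at `X` is nonnegative in all positive semidefinite directions, then the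
quadratic form of the localizing matrix is nonnegative at the vector `J ↦ hᵀ X^J v`. -/
theorem localizingMatrix_quadratic_nonneg {d n : ℕ} {c : Word d → ℂ} {k : Fin d}
    (hc' : Summable fun p : Fin d × Word d × Word d => ‖c (p.2.1 ++ p.1 :: p.2.2)‖)
    {X : MatTuple d n} (hX : IsSelfAdjointTuple X) (hX1 : ‖X‖ ≤ 1)
    (hder : ∀ H : MatTuple d n, (∀ i, (H i).PosSemidef) → ∀ v : Fin n → ℂ,
      0 ≤ star v ⬝ᵥ (∑' W, c W • wordDeriv X H W).mulVec v) (h v : Fin n → ℂ) :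
    0 ≤ ∑' p : Word d × Word d, localizingMatrix c k p.1 p.2 *
      (star (h ⬝ᵥ (wordEval X p.1).mulVec v) * (h ⬝ᵥ (wordEval X p.2).mulVec v)) := by
  classical
  rcases isEmpty_or_nonempty (Fin n) with hn | ⟨⟨z⟩⟩
  · simp
  -- The direction `B^* B` has the rank-one entry `h̄ hᵀ` in position `k` and zeros elsewhere.
  let B : MatTuple d n := Pi.single k (Matrix.vecMulVec (Pi.single z 1) h)
  have hs := hasSum_star_dotProduct_wordDeriv hc' hX hX1 B v
  have hpos := hder (fun i => (B i).conjTranspose * B i)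
    (fun i => Matrix.posSemidef_conjTranspose_mul_self _) v
  have hinj : Function.Injective fun p : Word d × Word d => (k, p) := fun p q hpq => by
    simpa using hpq
  rw [← hinj.hasSum_iff] at hs
  · rw [← hs.tsum_eq] at hpos
    have hB : ∀ u, (B k).mulVec u = Pi.single z (h ⬝ᵥ u) := fun u => by
      ext a
      simp only [B, Pi.single_eq_same, Matrix.vecMulVec_mulVec, op_smul_eq_smul]
      by_cases ha : a = z <;> simp [ha]
    refine hpos.trans_eq (tsum_congr fun p => ?_)
    simp only [Function.comp_apply, hB, ← Pi.single_star, single_dotProduct, Pi.single_eq_same]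
  · rintro ⟨i, p⟩ hp
    have hik : i ≠ k := by
      rintro rfl
      exact hp ⟨p, rfl⟩
    simp [B, hik]

theorem summable_localizingMatrix {d : ℕ} {c : Word d → ℂ}
    (hc' : Summable fun p : Fin d × Word d × Word d => ‖c (p.2.1 ++ p.1 :: p.2.2)‖) (k : Fin d) :
    Summable fun p : Word d × Word d => ‖localizingMatrix c k p.1 p.2‖ := by
  have hinj : Function.Injective fun p : Word d × Word d => (k, p.1.reverse, p.2) := by
    rintro ⟨I, J⟩ ⟨I', J'⟩ h
    simpa using h
  refine (hc'.comp_injective hinj).congr fun p => ?_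
  simp only [localizingMatrix, Matrix.of_apply, Function.comp_apply]

theorem tendsto_tsum_quadratic {α β : Type*} {M : Matrix α α ℂ}
    (hM : Summable fun p : α × α => ‖M p.1 p.2‖) {l : Filter β} {w : β → α → ℂ} {x : α → ℂ}
    {K : ℝ} (hK : ∀ᶠ s in l, ∀ i, ‖w s i‖ ≤ K)
    (hw : ∀ i, Filter.Tendsto (fun s => w s i) l (𝓝 (x i))) :
    Filter.Tendsto (fun s => ∑' p : α × α, M p.1 p.2 * (star (w s p.1) * w s p.2)) l
      (𝓝 (∑' p : α × α, M p.1 p.2 * (star (x p.1) * x p.2))) := by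
  refine tendsto_tsum_of_dominated_convergence (hM.mul_right (K * K))
    (fun p => ((hw p.1).star.mul (hw p.2)).const_mul _) ?_
  filter_upwards [hK] with s hs p
  rw [norm_mul, norm_mul, norm_star]
  have hK0 := (norm_nonneg _).trans (hs p.1)
  gcongr
  exacts [hs _, hs _]

/-- Nonnegativity of the derivative on a small ball forces the localizing matrix to be positive
semidefinite: the vectors `J ↦ hᵀ X^J v` approximate every finitely supported vector. -/
theorem posSemidef_localizingMatrix {d : ℕ} {c : Word d → ℂ} {r : ℝ} (hr : 0 < r) (hr1 : r ≤ 1)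
    (hc' : Summable fun p : Fin d × Word d × Word d => ‖c (p.2.1 ++ p.1 :: p.2.2)‖)
    (hder : ∀ (n : ℕ) (X : MatTuple d n), IsSelfAdjointTuple X → ‖X‖ < r →
      ∀ H : MatTuple d n, (∀ i, (H i).PosSemidef) → ∀ v : Fin n → ℂ,
      0 ≤ star v ⬝ᵥ (∑' W, c W • wordDeriv X H W).mulVec v) (k : Fin d) :
    (localizingMatrix c k).PosSemidef := by
  suffices hq : ∀ x : Word d →₀ ℂ,
      0 ≤ x.sum fun I xI => x.sum fun J xJ => star xI * localizingMatrix c k I J * xJ from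
    ⟨Matrix.isHermitian_of_forall_sum_nonneg hq, hq⟩
  intro x
  obtain ⟨n, X, v, h, K, hX, hX1, hK, hlim⟩ := exists_tendsto_dotProduct_wordEval x
  have hT := tendsto_tsum_quadratic (summable_localizingMatrix hc' k)
    (Filter.eventually_of_mem (Ioc_mem_nhdsGT one_pos) hK) hlim
  have hlimit := ge_of_tendsto hT (b := 0) (by
    filter_upwards [Ioo_mem_nhdsGT hr] with s hs
    have hsX : ‖s • X‖ < r := by
      rw [norm_smul, Real.norm_of_nonneg hs.1.le]
      exact (mul_le_of_le_one_right hs.1.le hX1).trans_lt hs.2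
    have hsX' : IsSelfAdjointTuple (s • X) := fun i => (hX i).smul (IsSelfAdjoint.all s)
    exact localizingMatrix_quadratic_nonneg hc' hsX' (hsX.le.trans hr1) (hder n _ hsX' hsX) _ _)
  rw [tsum_eq_sum (s := x.support ×ˢ x.support), Finset.sum_product] at hlimit
  · refine hlimit.trans_eq (Finset.sum_congr rfl fun I _ => Finset.sum_congr rfl fun J _ => ?_)
    ring
  · rintro ⟨I, J⟩ hIJ
    rw [Finset.mem_product, not_and_or, Finsupp.notMem_support_iff,
      Finsupp.notMem_support_iff] at hIJ
    rcases hIJ with h0 | h0 <;> simp [h0]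

/-! ### The derivative of `f` -/

theorem eventually_norm_add_smul_lt {E : Type*} [SeminormedAddCommGroup E] [NormedSpace ℝ E]
    {x : E} {r : ℝ} (hx : ‖x‖ < r) (y : E) : ∀ᶠ t : ℝ in 𝓝 0, ‖x + t • y‖ < r := by
  have hc : Continuous fun t : ℝ => ‖x + t • y‖ := by fun_prop
  exact hc.continuousAt.eventually_lt continuousAt_const (by simpa)

/-- The derivative of a matrix monotone function in a positive semidefinite direction is
positive semidefinite. -/
theorem IsMatrixMonotoneOn.star_dotProduct_deriv_nonneg {d n : ℕ} {r : ℝ} {f : GradedFun d}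
    (hf : IsMatrixMonotoneOn (realClosedBall d r) f) {X H : MatTuple d n}
    (hX : IsSelfAdjointTuple X) (hXr : ‖X‖ < r) (hH : ∀ i, (H i).PosSemidef)
    {L : Matrix (Fin n) (Fin n) ℂ} (hL : HasDerivAt (fun t : ℝ => f n (X + t • H)) L 0)
    (v : Fin n → ℂ) : 0 ≤ star v ⬝ᵥ L.mulVec v := by
  have hcont : Continuous fun A : Matrix (Fin n) (Fin n) ℂ => star v ⬝ᵥ A.mulVec v := by
    fun_prop
  refine ge_of_tendsto ((hcont.tendsto L).comp hL.tendsto_slope_zero_right) ?_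
  filter_upwards [nhdsWithin_le_nhds (eventually_norm_add_smul_lt hXr H),
    self_mem_nhdsWithin] with t ht ht0
  have hmono := hf n X ⟨hX, hXr.le⟩ (X + t • H)
    ⟨isSelfAdjointTuple_add_smul hX (fun i => (hH i).1) t, ht.le⟩ fun i => by
      simpa using (hH i).smul (le_of_lt ht0)
  simpa using (hmono.smul (inv_nonneg.2 (le_of_lt ht0))).dotProduct_mulVec_nonneg v

/-- On the unit ball the series converges absolutely, so its sum does not depend on the
enumeration. -/
theorem HasPowerSeriesOn.eq_tsum {d : ℕ} {r : ℝ} {e : ℕ ≃ Word d} {c : Word d → ℂ}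
    {f : GradedFun d} (h : HasPowerSeriesOn e c (realBall d r) f) (hr : 1 < r)
    (hc : Summable fun W => ‖c W‖) {n : ℕ} {X : MatTuple d n} (hX : IsSelfAdjointTuple X)
    (hX1 : ‖X‖ ≤ 1) : f n X = ∑' W, c W • wordEval X W := by
  have hs : Summable fun W => c W • wordEval X W := by
    refine Summable.of_norm_bounded hc fun W => ?_
    rw [norm_smul]
    exact mul_le_of_le_one_right (norm_nonneg _) (norm_wordEval_le_one hX1 W)
  exact tendsto_nhds_unique (h n X ⟨hX, hX1.trans_lt hr⟩)
    ((e.hasSum_iff.2 hs.hasSum).tendsto_sum_nat)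

/-- On a small ball the derivative of `f` is the termwise derivative of its power series. -/
theorem HasPowerSeriesOn.hasDerivAt {d : ℕ} {r : ℝ} {e : ℕ ≃ Word d} {c : Word d → ℂ}
    {f : GradedFun d} (h : HasPowerSeriesOn e c (realBall d r) f) (hr : 1 < r)
    (hc : Summable fun W => ‖c W‖)
    (hc' : Summable fun p : Fin d × Word d × Word d => ‖c (p.2.1 ++ p.1 :: p.2.2)‖)
    {n : ℕ} {X H : MatTuple d n} (hX : IsSelfAdjointTuple X) (hH : IsSelfAdjointTuple H)
    (hX1 : ‖X‖ < 1) :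
    HasDerivAt (fun t : ℝ => f n (X + t • H)) (∑' W, c W • wordDeriv X H W) 0 := by
  obtain ⟨δ, hδ, hball⟩ := Metric.eventually_nhds_iff_ball.1 (eventually_norm_add_smul_lt hX1 H)
  have hle : ∀ t ∈ Metric.ball (0 : ℝ) δ, ‖X + t • H‖ ≤ 1 := fun t ht => (hball t ht).le
  have hd := hasDerivAt_tsum_wordEval hc hc' Metric.isOpen_ball
    (convex_ball (0 : ℝ) δ).isPreconnected hle (Metric.mem_ball_self hδ)
  rw [zero_smul, add_zero] at hd
  refine hd.congr_of_eventuallyEq ?_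
  filter_upwards [Metric.ball_mem_nhds (0 : ℝ) hδ] with t ht
  exact h.eq_tsum hr hc (isSelfAdjointTuple_add_smul hX hH t) (hle t ht)

/-! ### Local and matrix monotonicity -/

theorem mainTheorem2 (d : ℕ) (ε : ℝ) (hε : 0 < ε) (e : ℕ ≃ Word d) (c : Word d → ℂ)
    (f : GradedFun d)
    (hfree : IsRealFree (realBall d (d + ε)) f)
    (hanalytic : IsRealAnalytic (realBall d (d + ε)) f)
    (hseries : HasPowerSeriesOn e c (realBall d (d + ε)) f) :
    (IsLocallyMonotone (realBall d (d + ε)) f →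
      ∀ k : Fin d, (localizingMatrix c k).PosSemidef ∧
        ∃ T : lp (fun _ : Word d => ℂ) 2 →L[ℂ] lp (fun _ : Word d => ℂ) 2,
          HasMatrix T (localizingMatrix c k) ∧ T.IsPositive ∧ IsCompactOperator T) ∧
    (IsMatrixMonotoneOn (realClosedBall d (1 / d)) f ↔
      ∀ k : Fin d, (localizingMatrix c k).PosSemidef) := by
  -- Over the empty alphabet there is only one word, which contradicts the enumeration `e`.
  have hd : 1 ≤ d := by
    rcases Nat.eq_zero_or_pos d with rfl | h
    · exact absurd (e.injective (Subsingleton.elim (e 0) (e 1))) zero_ne_one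
    · exact h
  have hd' : (1 : ℝ) ≤ d := by exact_mod_cast hd
  have hr : (1 : ℝ) < d + ε := by linarith
  have hinv : 0 < 1 / (d : ℝ) := by positivity
  have hinv1 : 1 / (d : ℝ) ≤ 1 := (div_le_one (by linarith)).2 hd'
  -- Any radius strictly between `d` and `d + ε` makes the coefficients absolutely summable.
  obtain ⟨C, hC⟩ := hseries.exists_norm_coeff_mul_pow_le (t := d + ε / 2) (by linarith)
    (by linarith)
  have hc := summable_coeff (by linarith) (by linarith) hC
  have hc' := summable_coeff_append_cons (by linarith) (by linarith) hC
  refine ⟨fun hmono k => ?_, fun hmono => ?_, fun hpos n X hX Y hY hXY => ?_⟩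
  · have hk := posSemidef_localizingMatrix one_pos le_rfl hc' (fun n X hX hX1 H hH v => ?_) k
    · exact ⟨hk, exists_hasMatrix_isPositive_isCompactOperator hk
        (summable_localizingMatrix hc' k)⟩
    · obtain ⟨L, hL, hLpos⟩ := hmono n X ⟨hX, hX1.trans hr⟩ H hH
      rw [(hseries.hasDerivAt hr hc hc' hX (fun i => (hH i).1) hX1).unique hL]
      exact hLpos.dotProduct_mulVec_nonneg v
  · exact posSemidef_localizingMatrix hinv hinv1 hc' fun n X hX hXd H hH v =>
      hmono.star_dotProduct_deriv_nonneg hX hXd hH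
        (hseries.hasDerivAt hr hc hc' hX (fun i => (hH i).1) (hXd.trans_le hinv1)) v
  · have hX1 := hX.2.trans hinv1
    have hY1 := hY.2.trans hinv1
    have hherm : (f n Y - f n X).IsHermitian :=
      (hfree.isHermitian n Y ⟨hY.1, hY1.trans_lt hr⟩).sub
        (hfree.isHermitian n X ⟨hX.1, hX1.trans_lt hr⟩)
    refine .of_dotProduct_mulVec_nonneg hherm fun v => Complex.nonneg_iff.2
      ⟨?_, (hherm.im_star_dotProduct_mulVec_self v).symm⟩
    rw [Matrix.sub_mulVec, dotProduct_sub, Complex.sub_re, sub_nonneg,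
      hseries.eq_tsum hr hc hX.1 hX1, hseries.eq_tsum hr hc hY.1 hY1]
    exact re_tsum_wordEval_le hc hc' hpos hX.1 hX1 hY1 hXY v
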